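/- All graphs are finite, simple and undirected. For a graph $X$ with adjacency matrix $A_X$, let $C(\mathrm{Qut}(X))$ be the universal unital $C^*$-algebra generated by elements $u_{xy}$ ($x,y\in V(X)$) subject to the relations that $U=(u_{xy})$ is a magic unitary (every $u_{xy}$ is a projection, $u_{xy}=u_{xy}^*=u_{xy}^2$, and every row and every column of $U$ sums to $1$) and that $A_XU=UA_X$. The graph $X$ is *quantum vertex transitive* if all its vertices lie in one orbit of its quantum automorphism group, i.e. $u_{xy}\neq 0$ in $C(\mathrm{Qut}(X))$ for all $x,y\in V(X)$. Graphs $X$ and $Y$ are *quantum isomorphic* if there are a nonzero Hilbert space $\mathcal H$ and a magic unitary $W=(w_{xy})_{x\in V(X),\,y\in V(Y)}$ with entries in $\mathcal B(\mathcal H)$ such that $A_XW=WA_Y$. **Theorem.** Let $X$ and $Y$ be quantum vertex transitive graphs which are quantum isomorphic but not isomorphic. Then the disjoint union of $X$ and $Y$ is quantum vertex transitive but not vertex transitive. -/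

import Mathlib

universe u v w

/-! ## Universal C*-algebras on self-adjoint generators -/

/-- A C*-seminorm on a complex unital *-algebra: a submultiplicative seminorm `p` with
`p (a* a) = p(a)^2`. -/
structure CStarSeminorm (P : Type*) [Ring P] [Algebra ℂ P] [StarRing P] extends
    Seminorm ℂ P where
  mul_le' : ∀ a b : P, toFun (a * b) ≤ toFun a * toFun b
  star_mul_self' : ∀ a : P, toFun (star a * a) = toFun a * toFun a

namespace CStarSeminorm

section Basic

variable {P : Type*} [Ring P] [Algebra ℂ P] [StarRing P]

instance : CoeFun (CStarSeminorm P) (fun _ => P → ℝ) := ⟨fun p => p.toFun⟩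

theorem nonneg (p : CStarSeminorm P) (a : P) : 0 ≤ p a := apply_nonneg p.toSeminorm a
theorem add_le (p : CStarSeminorm P) (a b : P) : p (a + b) ≤ p a + p b :=
  map_add_le_add p.toSeminorm a b
theorem zero_apply (p : CStarSeminorm P) : p 0 = 0 := map_zero p.toSeminorm
theorem neg_apply (p : CStarSeminorm P) (a : P) : p (-a) = p a := map_neg_eq_map p.toSeminorm a
theorem smul_apply (p : CStarSeminorm P) (c : ℂ) (a : P) : p (c • a) = ‖c‖ * p a :=
  map_smul_eq_mul p.toSeminorm c a
theorem mul_le (p : CStarSeminorm P) (a b : P) : p (a * b) ≤ p a * p b := p.mul_le' a b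
theorem star_mul_self (p : CStarSeminorm P) (a : P) : p (star a * a) = p a * p a :=
  p.star_mul_self' a

theorem le_star (p : CStarSeminorm P) (a : P) : p a ≤ p (star a) := by
  rcases (p.nonneg a).eq_or_lt with h | h
  · rw [← h]; exact p.nonneg _
  · have h1 := p.mul_le (star a) a
    rw [p.star_mul_self] at h1
    exact le_of_mul_le_mul_right h1 h

theorem star_apply (p : CStarSeminorm P) (a : P) : p (star a) = p a :=
  le_antisymm (by simpa using p.le_star (star a)) (p.le_star a)

/-- The seminorm `a ↦ ‖f a‖` for a *-homomorphism `f` to a C*-algebra. -/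
def ofStarAlgHom {B : Type*} [CStarAlgebra B] (f : P →⋆ₐ[ℂ] B) : CStarSeminorm P where
  toFun a := ‖f a‖
  map_zero' := by simp
  add_le' a b := by simpa using norm_add_le (f a) (f b)
  neg' a := by simp
  smul' c a := by simp [norm_smul]
  mul_le' a b := by simpa using norm_mul_le (f a) (f b)
  star_mul_self' a := by rw [map_mul, map_star, CStarRing.norm_star_mul_self]

/-- The pointwise supremum of a pointwise bounded family of C*-seminorms. -/
noncomputable def sup {ι : Type*} (p : ι → CStarSeminorm P)
    (hp : ∀ a, BddAbove (Set.range fun i => p i a)) : CStarSeminorm P where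
  toFun a := ⨆ i, p i a
  map_zero' := by simp [zero_apply]
  add_le' a b := by
    rcases isEmpty_or_nonempty ι with h | h
    · simp
    · exact ciSup_le fun i => ((p i).add_le a b).trans
        (add_le_add (le_ciSup (hp a) i) (le_ciSup (hp b) i))
  neg' a := by simp [neg_apply]
  smul' c a := by simp [smul_apply, Real.mul_iSup_of_nonneg (norm_nonneg c)]
  mul_le' a b := by
    rcases isEmpty_or_nonempty ι with h | h
    · simp
    · exact ciSup_le fun i => ((p i).mul_le a b).trans
        (mul_le_mul (le_ciSup (hp a) i) (le_ciSup (hp b) i) ((p i).nonneg b)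
          (((p i).nonneg a).trans (le_ciSup (hp a) i)))
  star_mul_self' a := by
    rcases isEmpty_or_nonempty ι with h | h
    · simp
    · have h0 : 0 ≤ ⨆ i, p i a := Real.iSup_nonneg fun i => (p i).nonneg a
      apply le_antisymm
      · refine ciSup_le fun i => ?_
        rw [(p i).star_mul_self]
        exact mul_self_le_mul_self ((p i).nonneg a) (le_ciSup (hp a) i)
      · have key : (⨆ i, p i a) ≤ Real.sqrt (⨆ i, p i (star a * a)) := by
          refine ciSup_le fun i => Real.le_sqrt_of_sq_le ?_
          rw [sq, ← (p i).star_mul_self]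
          exact le_ciSup (hp (star a * a)) i
        have h1 : 0 ≤ ⨆ i, p i (star a * a) := Real.iSup_nonneg fun i => (p i).nonneg _
        calc _ ≤ Real.sqrt (⨆ i, p i (star a * a)) * Real.sqrt (⨆ i, p i (star a * a)) :=
              mul_self_le_mul_self h0 key
          _ = _ := Real.mul_self_sqrt h1

/-- The *-algebra `P`, regarded as carrying the C*-seminorm `q`. -/
def Carrier (_q : CStarSeminorm P) : Type _ := P

variable (q : CStarSeminorm P)

instance : Ring q.Carrier := inferInstanceAs (Ring P)
instance : Algebra ℂ q.Carrier := inferInstanceAs (Algebra ℂ P)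
instance : StarRing q.Carrier := inferInstanceAs (StarRing P)
instance [StarModule ℂ P] : StarModule ℂ q.Carrier := inferInstanceAs (StarModule ℂ P)

instance : SeminormedRing q.Carrier where
  __ := (inferInstance : Ring q.Carrier)
  __ := (show AddGroupSeminorm q.Carrier from q.toAddGroupSeminorm).toSeminormedAddCommGroup
  norm_mul_le a b := q.mul_le a b

instance : NormedAlgebra ℂ q.Carrier where
  norm_smul_le c a := (q.smul_apply c a).le

theorem norm_carrier (a : q.Carrier) : ‖a‖ = q a := rfl

instance : NormedStarGroup q.Carrier where
  norm_star_le a := (q.star_apply a).le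

/-- The Hausdorff completion of `P` with respect to the C*-seminorm `q`, that is, the completion
of the quotient of `P` by the null ideal of `q`. -/
abbrev Completion : Type _ := UniformSpace.Completion q.Carrier

theorem isometry_star : Isometry (star : q.Carrier → q.Carrier) := star_isometry

noncomputable instance : StarRing q.Completion where
  star := UniformSpace.Completion.map star
  star_involutive a := by
    change UniformSpace.Completion.map star (UniformSpace.Completion.map star a) = a
    have hu := q.isometry_star.uniformContinuous
    rw [← Function.comp_apply (f := UniformSpace.Completion.map star),
      UniformSpace.Completion.map_comp hu hu]
    have : (star ∘ star : q.Carrier → q.Carrier) = id := by ext; simp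
    rw [this, UniformSpace.Completion.map_id, id]
  star_mul a b := by
    change UniformSpace.Completion.map star (a * b) =
      UniformSpace.Completion.map star b * UniformSpace.Completion.map star a
    have hu := q.isometry_star.uniformContinuous
    have hc : Continuous (UniformSpace.Completion.map (star : q.Carrier → q.Carrier)) :=
      UniformSpace.Completion.continuous_map
    induction a, b using UniformSpace.Completion.induction_on₂ with
    | hp => exact isClosed_eq (by fun_prop) (by fun_prop)
    | ih a b =>
      rw [← UniformSpace.Completion.coe_mul, UniformSpace.Completion.map_coe hu,
        UniformSpace.Completion.map_coe hu, UniformSpace.Completion.map_coe hu, star_mul,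
        UniformSpace.Completion.coe_mul]
  star_add a b := by
    change UniformSpace.Completion.map star (a + b) =
      UniformSpace.Completion.map star a + UniformSpace.Completion.map star b
    have hu := q.isometry_star.uniformContinuous
    have hc : Continuous (UniformSpace.Completion.map (star : q.Carrier → q.Carrier)) :=
      UniformSpace.Completion.continuous_map
    induction a, b using UniformSpace.Completion.induction_on₂ with
    | hp => exact isClosed_eq (by fun_prop) (by fun_prop)
    | ih a b =>
      rw [← UniformSpace.Completion.coe_add, UniformSpace.Completion.map_coe hu,
        UniformSpace.Completion.map_coe hu, UniformSpace.Completion.map_coe hu, star_add,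
        UniformSpace.Completion.coe_add]

theorem coe_star (a : q.Carrier) : ((star a : q.Carrier) : q.Completion) = star (a : q.Completion) :=
  (UniformSpace.Completion.map_coe q.isometry_star.uniformContinuous a).symm

theorem continuous_star : Continuous (star : q.Completion → q.Completion) :=
  UniformSpace.Completion.continuous_map

instance [StarModule ℂ P] : StarModule ℂ q.Completion where
  star_smul c a := by
    have hs := q.continuous_star
    induction a using UniformSpace.Completion.induction_on with
    | hp => exact isClosed_eq (hs.comp (continuous_const_smul c)) ((continuous_const_smul _).comp hs)
    | ih a =>
      rw [← UniformSpace.Completion.coe_smul, ← coe_star, ← coe_star,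
        ← UniformSpace.Completion.coe_smul, star_smul]

noncomputable instance [StarModule ℂ P] : CStarAlgebra q.Completion where
  norm_smul_le := norm_smul_le
  norm_mul_self_le a := by
    have hs := q.continuous_star
    induction a using UniformSpace.Completion.induction_on with
    | hp => exact isClosed_le (by fun_prop) (by fun_prop)
    | ih a =>
      rw [← coe_star, ← UniformSpace.Completion.coe_mul, UniformSpace.Completion.norm_coe,
        UniformSpace.Completion.norm_coe]
      exact (q.star_mul_self a).ge

/-- The canonical *-homomorphism from `P` to its completion. -/
noncomputable def toCompletion [StarModule ℂ P] : P →⋆ₐ[ℂ] q.Completion where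
  toFun a := UniformSpace.Completion.coeRingHom (α := q.Carrier) a
  map_one' := map_one (UniformSpace.Completion.coeRingHom (α := q.Carrier))
  map_mul' := map_mul (UniformSpace.Completion.coeRingHom (α := q.Carrier))
  map_zero' := map_zero (UniformSpace.Completion.coeRingHom (α := q.Carrier))
  map_add' := map_add (UniformSpace.Completion.coeRingHom (α := q.Carrier))
  commutes' _ := rfl
  map_star' a := q.coe_star a

theorem norm_toCompletion [StarModule ℂ P] (a : P) : ‖q.toCompletion a‖ = q a :=
  UniformSpace.Completion.norm_coe (E := q.Carrier) a

/-- A *-homomorphism to a C*-algebra that is contractive for `q` factors through the completion. -/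
theorem exists_lift [StarModule ℂ P] {B : Type*} [CStarAlgebra B] (f : P →⋆ₐ[ℂ] B)
    (hf : ∀ a, ‖f a‖ ≤ q a) :
    ∃ g : q.Completion →⋆ₐ[ℂ] B, ∀ a, g (q.toCompletion a) = f a := by
  let f' : q.Carrier →+* B := (f : P →+* B)
  have hf' : Continuous f' :=
    AddMonoidHomClass.continuous_of_bound f' 1 fun a => by
      rw [one_mul]; exact hf a
  let g := UniformSpace.Completion.extensionHom f' hf'
  have hg : ∀ a : q.Carrier, g (a : q.Completion) = f a :=
    UniformSpace.Completion.extensionHom_coe f' hf'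
  have hgc : Continuous g := UniformSpace.Completion.continuous_extension
  refine ⟨{ g with commutes' := fun c => ?_, map_star' := fun a => ?_ }, hg⟩
  · exact (hg (algebraMap ℂ P c)).trans (AlgHomClass.commutes f c)
  · change g (star a) = star (g a)
    have hs := q.continuous_star
    induction a using UniformSpace.Completion.induction_on with
    | hp => exact isClosed_eq (by fun_prop) (by fun_prop)
    | ih a => rw [← coe_star, hg, hg]; exact map_star f _

end Basic

end CStarSeminorm

/-- The free unital complex algebra on a set `G` of generators, i.e. the noncommutative polynomials
in `G` over `ℂ`. With the conjugate-linear involution that fixes every generator it is the free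
unital *-algebra on self-adjoint generators `G`. -/
abbrev FreeSAAlgebra (G : Type*) : Type _ := MonoidAlgebra ℂ (FreeMonoid G)

namespace FreeSAAlgebra

variable {G : Type*}

noncomputable instance : StarRing (FreeSAAlgebra G) where
  star a := MonoidAlgebra.mapDomain star (MonoidAlgebra.map (starRingEnd ℂ).toAddMonoidHom a)
  star_involutive a := by
    induction a using MonoidAlgebra.induction_linear with
    | zero => simp
    | add f g hf hg => simp_all [MonoidAlgebra.map_add, MonoidAlgebra.mapDomain_add]
    | single m r => simp
  star_mul a b := by
    induction a using MonoidAlgebra.induction_linear with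
    | zero => simp
    | add f g hf hg =>
      simp_all [MonoidAlgebra.map_add, MonoidAlgebra.mapDomain_add, add_mul, mul_add]
    | single m r =>
      induction b using MonoidAlgebra.induction_linear with
      | zero => simp
      | add f g hf hg =>
        simp_all [MonoidAlgebra.map_add, MonoidAlgebra.mapDomain_add, add_mul, mul_add]
      | single n s => simp [MonoidAlgebra.single_mul_single, mul_comm]
  star_add a b := by simp [MonoidAlgebra.map_add, MonoidAlgebra.mapDomain_add]

theorem star_single (m : FreeMonoid G) (c : ℂ) :
    star (MonoidAlgebra.single m c : FreeSAAlgebra G) =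
      MonoidAlgebra.single (star m) (starRingEnd ℂ c) := by
  change MonoidAlgebra.mapDomain star (MonoidAlgebra.map _ _) = _
  simp

instance : StarModule ℂ (FreeSAAlgebra G) where
  star_smul c a := by
    induction a using MonoidAlgebra.induction_linear with
    | zero => simp
    | add f g hf hg => simp_all
    | single m r => simp [star_single]

/-- The generator indexed by `g`. -/
noncomputable def gen (g : G) : FreeSAAlgebra G := MonoidAlgebra.single (FreeMonoid.of g) 1

theorem star_gen (g : G) : star (gen g) = gen g := by simp [gen, star_single]

/-- The universal property of the free *-algebra on self-adjoint generators. -/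
theorem exists_lift {B : Type*} [Ring B] [Algebra ℂ B] [StarRing B] [StarModule ℂ B] (b : G → B)
    (hb : ∀ g, IsSelfAdjoint (b g)) : ∃ f : FreeSAAlgebra G →⋆ₐ[ℂ] B, ∀ g, f (gen g) = b g := by
  have hs : ∀ m : FreeMonoid G, FreeMonoid.lift b (star m) = star (FreeMonoid.lift b m) := by
    intro m
    induction m using FreeMonoid.recOn with
    | one => simp
    | of_mul g m hm => simp [hm, (hb g).star_eq]
  refine ⟨{ MonoidAlgebra.lift ℂ B (FreeMonoid G) (FreeMonoid.lift b) with
    map_star' := fun a => ?_ }, fun g => ?_⟩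
  · change MonoidAlgebra.lift ℂ B (FreeMonoid G) (FreeMonoid.lift b) (star a) =
      star (MonoidAlgebra.lift ℂ B (FreeMonoid G) (FreeMonoid.lift b) a)
    induction a using MonoidAlgebra.induction_linear with
    | zero => simp
    | add f g hf hg => simp only [star_add, map_add, hf, hg]
    | single m r => simp [star_single, hs]
  · change MonoidAlgebra.lift ℂ B (FreeMonoid G) (FreeMonoid.lift b) (gen g) = b g
    simp [gen]

theorem hom_ext {B : Type*} [Ring B] [Algebra ℂ B] [StarRing B] (f g : FreeSAAlgebra G →⋆ₐ[ℂ] B)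
    (h : ∀ x, f (gen x) = g (gen x)) (a : FreeSAAlgebra G) : f a = g a := by
  induction a using MonoidAlgebra.induction_linear with
  | zero => simp
  | add a b ha hb => simp [ha, hb]
  | single m r =>
    have hm : f (MonoidAlgebra.single m 1) = g (MonoidAlgebra.single m 1) := by
      induction m using FreeMonoid.recOn with
      | one => exact (map_one f).trans (map_one g).symm
      | of_mul x m hm =>
        have : (MonoidAlgebra.single (FreeMonoid.of x * m) 1 : FreeSAAlgebra G) =
            gen x * MonoidAlgebra.single m 1 := by
          rw [gen, MonoidAlgebra.single_mul_single, one_mul]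
        rw [this, map_mul, map_mul, h, hm]
    have hr : (MonoidAlgebra.single m r : FreeSAAlgebra G) = r • MonoidAlgebra.single m 1 := by
      rw [MonoidAlgebra.smul_single, smul_eq_mul, mul_one]
    rw [hr, map_smul, map_smul, hm]

end FreeSAAlgebra

/-! ## Magic unitaries and the quantum automorphism group of a graph -/

/-- A matrix with entries in a *-ring is a magic unitary if its entries are (self-adjoint)
projections and each of its rows and columns sums to `1`. -/
structure IsMagicUnitary {V W A : Type*} [Fintype V] [Fintype W] [Ring A] [StarRing A]
    (U : Matrix V W A) : Prop where
  proj : ∀ x y, IsStarProjection (U x y)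
  row_sum : ∀ x, ∑ y, U x y = 1
  col_sum : ∀ y, ∑ x, U x y = 1

namespace SimpleGraph

open Classical in
/-- `U` intertwines the adjacency matrices of `X` and `Y`: `A_X U = U A_Y`. The scalar matrices
`A_X`, `A_Y` are regarded as matrices over the algebra `A`. -/
def Intertwines {V W A : Type*} [Fintype V] [Fintype W] [Ring A]
    (X : SimpleGraph V) (Y : SimpleGraph W) (U : Matrix V W A) : Prop :=
  X.adjMatrix A * U = U * Y.adjMatrix A

section QuantumAutomorphism

variable {V : Type*} [Fintype V] (X : SimpleGraph V)

/-- The matrix of free self-adjoint generators indexed by pairs of vertices. -/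
noncomputable def freeMatrix (V : Type*) : Matrix V V (FreeSAAlgebra (V × V)) :=
  Matrix.of fun x y => FreeSAAlgebra.gen (x, y)

open Classical in
/-- The elements that have to vanish for the (self-adjoint) generators `u x y` to form a magic
unitary `u` with `A_X u = u A_X`. -/
def qutRelators : Set (FreeSAAlgebra (V × V)) :=
  {r | (∃ x y, r = freeMatrix V x y * freeMatrix V x y - freeMatrix V x y) ∨
    (∃ x, r = ∑ y, freeMatrix V x y - 1) ∨
    (∃ y, r = ∑ x, freeMatrix V x y - 1) ∨
    (∃ x y, r = (X.adjMatrix (FreeSAAlgebra (V × V)) * freeMatrix V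
      - freeMatrix V * X.adjMatrix (FreeSAAlgebra (V × V))) x y)}

/-- The C*-seminorms on the free *-algebra for which the defining relations hold. -/
abbrev QutSeminorm : Type _ :=
  {p : CStarSeminorm (FreeSAAlgebra (V × V)) // ∀ r ∈ X.qutRelators, p r = 0}

theorem qutSeminorm_bddAbove (a : FreeSAAlgebra (V × V)) :
    BddAbove (Set.range fun p : X.QutSeminorm => p.1 a) := by
  have le_one : ∀ t : ℝ, t * t ≤ t → t ≤ 1 := fun t ht => by nlinarith
  induction a using MonoidAlgebra.induction_linear with
  | zero => exact ⟨0, by rintro _ ⟨p, rfl⟩; exact p.1.zero_apply.le⟩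
  | add f g hf hg =>
    obtain ⟨c, hc⟩ := hf
    obtain ⟨d, hd⟩ := hg
    exact ⟨c + d, by
      rintro _ ⟨p, rfl⟩
      exact (p.1.add_le f g).trans (add_le_add (hc ⟨p, rfl⟩) (hd ⟨p, rfl⟩))⟩
  | single m r =>
    refine ⟨‖r‖ * 1, ?_⟩
    rintro _ ⟨p, rfl⟩
    have hm : p.1 (MonoidAlgebra.single m 1) ≤ 1 := by
      induction m using FreeMonoid.recOn with
      | one =>
        change p.1 (1 : FreeSAAlgebra (V × V)) ≤ 1
        refine le_one _ ?_
        have := p.1.star_mul_self (1 : FreeSAAlgebra (V × V))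
        rw [star_one, one_mul] at this
        exact this.ge
      | of_mul g m hm =>
        have hg : p.1 (FreeSAAlgebra.gen g) ≤ 1 := by
          refine le_one _ ?_
          have h1 := p.1.star_mul_self (FreeSAAlgebra.gen g)
          rw [FreeSAAlgebra.star_gen] at h1
          have h2 := p.2 _ (Or.inl ⟨g.1, g.2, rfl⟩)
          have h3 := p.1.add_le (FreeSAAlgebra.gen g * FreeSAAlgebra.gen g - FreeSAAlgebra.gen g)
            (FreeSAAlgebra.gen g)
          rw [sub_add_cancel, h1] at h3
          simp only [freeMatrix, Matrix.of_apply] at h2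
          rw [h2, zero_add] at h3
          exact h3
        have h4 := p.1.mul_le (FreeSAAlgebra.gen g) (MonoidAlgebra.single m 1)
        rw [FreeSAAlgebra.gen, MonoidAlgebra.single_mul_single, one_mul] at h4
        exact h4.trans (mul_le_one₀ hg (p.1.nonneg _) hm)
    have h5 := p.1.smul_apply r (MonoidAlgebra.single m 1)
    rw [MonoidAlgebra.smul_single, smul_eq_mul, mul_one] at h5
    exact h5.le.trans (mul_le_mul_of_nonneg_left hm (norm_nonneg r))

/-- The largest C*-seminorm for which the defining relations hold. -/
noncomputable def qutNorm : CStarSeminorm (FreeSAAlgebra (V × V)) :=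
  CStarSeminorm.sup (fun p : X.QutSeminorm => p.1) X.qutSeminorm_bddAbove

/-- The quantum symmetry algebra `C(Qut(X))` of the graph `X`: the universal C*-algebra generated by
elements `u x y`, for `x y` vertices, subject to the relations that `u` is a magic unitary with
`A_X u = u A_X`. It is constructed as the completion of the free *-algebra with respect to the
largest C*-seminorm for which the relations hold; `existsUnique_qutLift` is its universal
property. -/
def QutAlgebra : Type _ := X.qutNorm.Completion

noncomputable instance : CStarAlgebra X.QutAlgebra :=
  inferInstanceAs (CStarAlgebra X.qutNorm.Completion)

/-- The canonical *-homomorphism from the free *-algebra. -/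
noncomputable def qutMk : FreeSAAlgebra (V × V) →⋆ₐ[ℂ] X.QutAlgebra := X.qutNorm.toCompletion

/-- The magic unitary of canonical generators of `C(Qut(X))`. -/
noncomputable def qutGen : Matrix V V X.QutAlgebra :=
  Matrix.of fun x y => X.qutMk (FreeSAAlgebra.gen (x, y))

theorem qutMk_relator {r : FreeSAAlgebra (V × V)} (hr : r ∈ X.qutRelators) : X.qutMk r = 0 := by
  have h : ‖X.qutMk r‖ = X.qutNorm r := X.qutNorm.norm_toCompletion r
  rw [← norm_eq_zero, h]
  change (⨆ p : X.QutSeminorm, p.1 r) = 0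
  simp [fun p : X.QutSeminorm => p.2 r hr]

theorem qutGen_isMagicUnitary : IsMagicUnitary X.qutGen where
  proj x y := by
    refine ⟨?_, ?_⟩
    · have := X.qutMk_relator (Or.inl ⟨x, y, rfl⟩)
      rw [map_sub, map_mul, sub_eq_zero] at this
      exact this
    · change star _ = _
      simp only [qutGen, Matrix.of_apply]
      rw [← map_star, FreeSAAlgebra.star_gen]
  row_sum x := by
    have := X.qutMk_relator (Or.inr (Or.inl ⟨x, rfl⟩))
    rw [map_sub, map_sum, map_one, sub_eq_zero] at this
    exact this
  col_sum y := by
    have := X.qutMk_relator (Or.inr (Or.inr (Or.inl ⟨y, rfl⟩)))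
    rw [map_sub, map_sum, map_one, sub_eq_zero] at this
    exact this

theorem map_intertwines_apply {A B : Type*} [Ring A] [Algebra ℂ A] [Star A] [Ring B]
    [Algebra ℂ B] [Star B] (f : A →⋆ₐ[ℂ] B) (D : Matrix V V A) (x y : V) [DecidableRel X.Adj] :
    f ((X.adjMatrix A * D - D * X.adjMatrix A) x y) =
      (X.adjMatrix B * D.map f - D.map f * X.adjMatrix B) x y := by
  simp [Matrix.mul_apply, SimpleGraph.adjMatrix_apply, apply_ite f]

theorem qutGen_intertwines : X.Intertwines X X.qutGen := by
  classical
  rw [Intertwines, ← sub_eq_zero]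
  ext x y
  have := X.qutMk_relator (Or.inr (Or.inr (Or.inr ⟨x, y, rfl⟩)))
  rw [map_intertwines_apply] at this
  exact this

/-- The universal property of `C(Qut(X))`, for C*-algebras in any universe. -/
theorem existsUnique_qutLift {B : Type*} [CStarAlgebra B] (U : Matrix V V B)
    (hU : IsMagicUnitary U) (hX : X.Intertwines X U) :
    ∃! φ : X.QutAlgebra →⋆ₐ[ℂ] B, ∀ x y, φ (X.qutGen x y) = U x y := by
  classical
  obtain ⟨f, hf⟩ := FreeSAAlgebra.exists_lift (fun g : V × V => U g.1 g.2)
    (fun g => (hU.proj g.1 g.2).isSelfAdjoint)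
  have hfU : (freeMatrix V).map f = U := by ext x y; exact hf (x, y)
  have hf' : ∀ x y, f (freeMatrix V x y) = U x y := fun x y => hf (x, y)
  have hrel : ∀ r ∈ X.qutRelators, f r = 0 := by
    rintro r (⟨x, y, rfl⟩ | ⟨x, rfl⟩ | ⟨y, rfl⟩ | ⟨x, y, rfl⟩)
    · rw [map_sub, map_mul, hf', sub_eq_zero]
      exact (hU.proj x y).isIdempotentElem
    · simp only [map_sub, map_sum, map_one, hf', hU.row_sum, sub_self]
    · simp only [map_sub, map_sum, map_one, hf', hU.col_sum, sub_self]
    · rw [map_intertwines_apply, hfU, sub_eq_zero.mpr]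
      · rfl
      · unfold Intertwines at hX
        convert hX
  let p : X.QutSeminorm := ⟨CStarSeminorm.ofStarAlgHom f, fun r hr => by
    change ‖f r‖ = 0
    rw [hrel r hr, norm_zero]⟩
  obtain ⟨g, hg⟩ := X.qutNorm.exists_lift f fun a => le_ciSup (X.qutSeminorm_bddAbove a) p
  refine ⟨g, fun x y => (hg _).trans (hf' x y), fun g' hg' => ?_⟩
  have hfree : ∀ a, g' (X.qutMk a) = g (X.qutMk a) := by
    refine fun a => FreeSAAlgebra.hom_ext (g'.comp X.qutMk) (g.comp X.qutMk) (fun z => ?_) a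
    exact (hg' z.1 z.2).trans ((hg _).trans (hf' z.1 z.2)).symm
  have hc' : Continuous g' :=
    AddMonoidHomClass.continuous_of_bound g' 1 fun a => by
      rw [one_mul]; exact NonUnitalStarAlgHom.norm_apply_le g' a
  have hc : Continuous (g : X.QutAlgebra →⋆ₐ[ℂ] B) :=
    AddMonoidHomClass.continuous_of_bound (g : X.QutAlgebra →⋆ₐ[ℂ] B) 1 fun a => by
      rw [one_mul]; exact NonUnitalStarAlgHom.norm_apply_le (g : X.QutAlgebra →⋆ₐ[ℂ] B) a
  have hd : DenseRange X.qutMk := UniformSpace.Completion.denseRange_coe (α := X.qutNorm.Carrier)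
  exact DFunLike.coe_injective (hd.equalizer hc' hc (funext hfree))

/-- Vertices `x`, `y` are in the same quantum orbit of `X`: the canonical generator `u x y` of
`C(Qut(X))` is nonzero. -/
def QuantumOrbitRel (x y : V) : Prop := X.qutGen x y ≠ 0

/-- `X` is quantum vertex transitive: all vertices are in one quantum orbit. -/
def IsQuantumVertexTransitive : Prop := ∀ x y : V, X.QuantumOrbitRel x y

end QuantumAutomorphism

/-- `X` is vertex transitive: all vertices are in one orbit of the automorphism group. -/
def IsVertexTransitive {V : Type*} (X : SimpleGraph V) : Prop :=
  ∀ x y : V, ∃ φ : X ≃g X, φ x = y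

/-- `X` and `Y` are quantum isomorphic: on some nonzero Hilbert space `H` there is a magic unitary
`U`, with rows indexed by the vertices of `X` and columns indexed by the vertices of `Y` and entries
bounded operators on `H`, such that `A_X U = U A_Y`. -/
def QuantumIsomorphic {V : Type u} {W : Type v} [Fintype V] [Fintype W] (X : SimpleGraph V)
    (Y : SimpleGraph W) : Prop :=
  ∃ (H : Type w) (_ : NormedAddCommGroup H) (_ : InnerProductSpace ℂ H) (_ : CompleteSpace H)
    (_ : Nontrivial H) (U : Matrix V W (H →L[ℂ] H)), IsMagicUnitary U ∧ X.Intertwines Y U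

end SimpleGraph

/-! ## Magic unitaries -/

/-! Any magic unitary over a C*-algebra that intertwines a graph with itself receives a homomorphism
from the universal algebra, so a single nonzero entry of it already shows that the corresponding
generator is nonzero (`QuantumOrbitRel.of_magicUnitary`). It therefore suffices to exhibit, for each
pair of vertices of the disjoint union, one such matrix that is nonzero there.

For two vertices of the same graph, the block diagonal matrix of its universal magic unitary and an
identity matrix works. For `x` in `X` and `y` in `Y`, take an intertwiner `U` on `H` from the
quantum isomorphism. Its row `x` has a nonzero entry, at `z` say, and by transitivity of `Y` the
generator at `(z, y)` is nonzero, so some representation on a Hilbert space `K` does not kill it. On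
the completed tensor product of `H` and `K`, the entries of `U ⊗ 1` and `1 ⊗ π(u)` commute, so the
product is a magic unitary. Orthogonality within rows prevents cancellation in its entry at `(x, y)`
(`mul_apply_ne_zero`). The block antidiagonal matrix of this product and its transpose then joins
the two graphs.

The classical half is counting. A vertex transitive disjoint union has pairwise isomorphic
components, and quantum isomorphic graphs have equally many vertices. Hence `X` and `Y` have equally
many copies of the same component and are isomorphic (`IsVertexTransitive.nonempty_iso_of_sum`). -/

namespace IsMagicUnitary

section StarRing

variable {V W A : Type*} [Fintype V] [Fintype W] [Ring A] [StarRing A]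

theorem transpose {U : Matrix V W A} (hU : IsMagicUnitary U) : IsMagicUnitary U.transpose where
  proj x y := hU.proj y x
  row_sum x := hU.col_sum x
  col_sum y := hU.row_sum y

theorem map {B F : Type*} [Ring B] [StarRing B] [FunLike F A B] [RingHomClass F A B]
    [StarHomClass F A B] {U : Matrix V W A} (hU : IsMagicUnitary U) (f : F) :
    IsMagicUnitary (U.map f) where
  proj x y := (hU.proj x y).map f
  row_sum x := by simp [← map_sum, hU.row_sum]
  col_sum y := by simp [← map_sum, hU.col_sum]

theorem one [DecidableEq V] : IsMagicUnitary (1 : Matrix V V A) where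
  proj x y := by
    rcases eq_or_ne x y with rfl | h
    · simp
    · simp [Matrix.one_apply_ne h]
  row_sum x := by simp [Matrix.one_apply]
  col_sum y := by simp [Matrix.one_apply]

theorem fromBlocks_diagonal {U : Matrix V V A} {U' : Matrix W W A} (hU : IsMagicUnitary U)
    (hU' : IsMagicUnitary U') : IsMagicUnitary (Matrix.fromBlocks U 0 0 U') where
  proj := by
    rintro (x | x) (y | y)
    exacts [hU.proj x y, IsStarProjection.zero A, IsStarProjection.zero A, hU'.proj x y]
  row_sum := by rintro (x | x) <;> simp [hU.row_sum, hU'.row_sum]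
  col_sum := by rintro (x | x) <;> simp [hU.col_sum, hU'.col_sum]

theorem fromBlocks_antidiagonal {U : Matrix V W A} {U' : Matrix W V A} (hU : IsMagicUnitary U)
    (hU' : IsMagicUnitary U') : IsMagicUnitary (Matrix.fromBlocks 0 U U' 0) where
  proj := by
    rintro (x | x) (y | y)
    exacts [IsStarProjection.zero A, hU.proj x y, hU'.proj x y, IsStarProjection.zero A]
  row_sum := by rintro (x | x) <;> simp [hU.row_sum, hU'.row_sum]
  col_sum := by rintro (x | x) <;> simp [hU.col_sum, hU'.col_sum]

/-- Summing all entries by rows and by columns counts the two index sets; characteristic zero turns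
this into an equality of natural numbers. -/
theorem card_eq [Nontrivial A] [CharZero A] {U : Matrix V W A} (hU : IsMagicUnitary U) :
    Fintype.card V = Fintype.card W := by
  have h : ∑ x, ∑ y, U x y = ∑ y, ∑ x, U x y := Finset.sum_comm
  simp only [hU.row_sum, hU.col_sum, Finset.sum_const, Finset.card_univ, nsmul_eq_mul,
    mul_one] at h
  exact_mod_cast h

/-- Every row of a magic unitary over a nontrivial ring has a nonzero entry. -/
theorem exists_ne_zero [Nontrivial A] {U : Matrix V W A} (hU : IsMagicUnitary U) (x : V) :
    ∃ y, U x y ≠ 0 := by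
  by_contra! h
  simpa [h] using hU.row_sum x

end StarRing

/-! ### Orthogonality within rows, and products of magic unitaries -/

section CStarAlgebra

variable {V W Z A : Type*} [Fintype V] [Fintype W] [Fintype Z] [CStarAlgebra A]

/-- Distinct entries in a row of a magic unitary over a C*-algebra are orthogonal. -/
theorem mul_eq_zero_of_ne {U : Matrix V W A} (hU : IsMagicUnitary U) (x : V) {y z : W}
    (h : y ≠ z) : U x y * U x z = 0 := by
  classical
  let := CStarAlgebra.spectralOrder A
  have := CStarAlgebra.spectralOrderedRing A
  -- The remaining entries of the row are positive, so two of them sum to at most 1. For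
  -- projections, `p ≤ 1 - q` means `p * (1 - q) = p`.
  have hle : U x y ≤ 1 - U x z := by
    rw [le_sub_iff_add_le, ← hU.row_sum x, ← Finset.sum_pair h]
    exact Finset.sum_le_sum_of_subset_of_nonneg (Finset.subset_univ _)
      fun i _ _ => (hU.proj x i).nonneg
  have := ((hU.proj x y).le_iff_mul_eq_left (hU.proj x z).one_sub).1 hle
  simpa [mul_sub] using this

/-- The product of two magic unitaries whose entries commute with each other. -/
theorem mul {U : Matrix V W A} {U' : Matrix W Z A} (hU : IsMagicUnitary U)
    (hU' : IsMagicUnitary U') (hc : ∀ x y y' z, Commute (U x y) (U' y' z)) :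
    IsMagicUnitary (U * U') where
  proj x z := by
    classical
    refine ⟨?_, ?_⟩
    · change (∑ y, U x y * U' y z) * (∑ y, U x y * U' y z) = ∑ y, U x y * U' y z
      rw [Finset.sum_mul_sum]
      refine Finset.sum_congr rfl fun y _ => ?_
      -- Commutation brings the two entries of row `x` of `U` together, so the cross terms vanish by
      -- orthogonality.
      rw [Finset.sum_eq_single y]
      · rw [(hc x y y z).symm.mul_mul_mul_comm, (hU.proj x y).isIdempotentElem.eq,
          (hU'.proj y z).isIdempotentElem.eq]
      · intro y' _ h
        rw [(hc x y' y z).symm.mul_mul_mul_comm, hU.mul_eq_zero_of_ne x h.symm, zero_mul]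
      · simp
    · change star (∑ y, U x y * U' y z) = ∑ y, U x y * U' y z
      rw [star_sum]
      refine Finset.sum_congr rfl fun y _ => ?_
      rw [star_mul, (hU.proj x y).isSelfAdjoint.star_eq, (hU'.proj y z).isSelfAdjoint.star_eq]
      exact (hc x y y z).symm.eq
  row_sum x := by
    simp only [Matrix.mul_apply]
    rw [Finset.sum_comm]
    simp [← Finset.mul_sum, hU.row_sum, hU'.row_sum]
  col_sum z := by
    simp only [Matrix.mul_apply]
    rw [Finset.sum_comm]
    simp [← Finset.sum_mul, hU.col_sum, hU'.col_sum]

/-- Left multiplication by `U x y` isolates one summand of the product entry, since the entries of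
row `x` of `U` are mutually orthogonal. Neither commutation nor any property of `U'` is needed. -/
theorem mul_apply_ne_zero {Z : Type*} {U : Matrix V W A} {U' : Matrix W Z A}
    (hU : IsMagicUnitary U) {x : V} {y : W} {z : Z} (h : U x y * U' y z ≠ 0) : (U * U') x z ≠ 0 := by
  classical
  intro h0
  apply h
  have : U x y * (U * U') x z = U x y * U' y z := by
    rw [Matrix.mul_apply, Finset.mul_sum, Finset.sum_eq_single y]
    · rw [← mul_assoc, (hU.proj x y).isIdempotentElem.eq]
    · intro y' _ h'
      rw [← mul_assoc, hU.mul_eq_zero_of_ne x h'.symm, zero_mul]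
    · simp
  rw [← this, h0, mul_zero]

end CStarAlgebra

end IsMagicUnitary

/-! ### Matrices intertwining adjacency matrices -/

namespace SimpleGraph

namespace Intertwines

variable {V W Z A : Type*} [Fintype V] [Fintype W] [Fintype Z] [Ring A]
  {X : SimpleGraph V} {Y : SimpleGraph W} {T : SimpleGraph Z}

theorem one [DecidableEq V] : X.Intertwines X (1 : Matrix V V A) := by
  simp [Intertwines]

theorem mul {U : Matrix V W A} {U' : Matrix W Z A} (h : X.Intertwines Y U)
    (h' : Y.Intertwines T U') : X.Intertwines T (U * U') := by
  unfold Intertwines at *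
  rw [← Matrix.mul_assoc, h, Matrix.mul_assoc, h', Matrix.mul_assoc]

theorem map {B F : Type*} [Ring B] [FunLike F A B] [RingHomClass F A B] {U : Matrix V W A}
    (h : X.Intertwines Y U) (f : F) : X.Intertwines Y (U.map f) := by
  unfold Intertwines at *
  ext x y
  have := congr_arg f (congr_fun (congr_fun h x) y)
  simpa [Matrix.mul_apply, adjMatrix_apply, apply_ite f] using this

/-- Transposition does not reverse products over a noncommutative ring in general, but here one
factor has entries 0 and 1, which are central. Symmetry of adjacency does the rest. -/
theorem transpose {U : Matrix V W A} (h : X.Intertwines Y U) :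
    Y.Intertwines X U.transpose := by
  unfold Intertwines at *
  ext x y
  have := congr_fun (congr_fun h y) x
  simp only [Matrix.mul_apply, adjMatrix_apply, Matrix.transpose_apply, ite_mul, mul_ite, one_mul,
    mul_one, zero_mul, mul_zero] at this ⊢
  classical
  exact ((Finset.sum_congr rfl fun j _ => if_congr (Y.adj_comm x j) rfl rfl).trans this.symm).trans
    (Finset.sum_congr rfl fun j _ => if_congr (X.adj_comm y j) rfl rfl)

theorem sum_diagonal {U : Matrix V V A} {U' : Matrix W W A} (h : X.Intertwines X U)
    (h' : Y.Intertwines Y U') :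
    (SimpleGraph.sum X Y).Intertwines (SimpleGraph.sum X Y) (Matrix.fromBlocks U 0 0 U') := by
  unfold Intertwines at *
  ext (x | x) (y | y)
  · simpa [Matrix.mul_apply, adjMatrix_apply, sum_adj_inl, sum_adj_inr]
      using! congr_fun (congr_fun h x) y
  · simp [Matrix.mul_apply, adjMatrix_apply]
  · simp [Matrix.mul_apply, adjMatrix_apply]
  · simpa [Matrix.mul_apply, adjMatrix_apply, sum_adj_inl, sum_adj_inr]
      using! congr_fun (congr_fun h' x) y

theorem sum_antidiagonal {U : Matrix V W A} {U' : Matrix W V A} (h : X.Intertwines Y U)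
    (h' : Y.Intertwines X U') :
    (SimpleGraph.sum X Y).Intertwines (SimpleGraph.sum X Y) (Matrix.fromBlocks 0 U U' 0) := by
  unfold Intertwines at *
  ext (x | x) (y | y)
  · simp [Matrix.mul_apply, adjMatrix_apply]
  · simpa [Matrix.mul_apply, adjMatrix_apply, sum_adj_inl, sum_adj_inr]
      using! congr_fun (congr_fun h x) y
  · simpa [Matrix.mul_apply, adjMatrix_apply, sum_adj_inl, sum_adj_inr]
      using! congr_fun (congr_fun h' x) y
  · simp [Matrix.mul_apply, adjMatrix_apply]

end Intertwines

/-- The homomorphism given by the universal property sends the generator to `U x y`, and it would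
send zero to zero. -/
theorem QuantumOrbitRel.of_magicUnitary {V : Type*} [Fintype V] {X : SimpleGraph V} {B : Type*}
    [CStarAlgebra B] {U : Matrix V V B} (hU : IsMagicUnitary U) (hX : X.Intertwines X U) {x y : V}
    (h : U x y ≠ 0) : X.QuantumOrbitRel x y := by
  obtain ⟨φ, hφ, -⟩ := X.existsUnique_qutLift U hU hX
  intro h0
  exact h (by rw [← hφ, h0, map_zero])

end SimpleGraph

/-! ## States and representations -/

section States

variable {A : Type*} [CStarAlgebra A]

/-- A contractive unital functional on a C*-algebra takes real values on self-adjoint elements. -/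
theorem StrongDual.im_apply_eq_zero {g : StrongDual ℂ A} (hg : ‖g‖ ≤ 1) (h1 : g 1 = 1) {a : A}
    (ha : IsSelfAdjoint a) : (g a).im = 0 := by
  have : Nontrivial A := ⟨1, 0, fun h => by simp [h] at h1⟩
  have key : ∀ t : ℝ, 2 * (g a).im * t ≤ ‖a‖ ^ 2 := by
    intro t
    -- Shifting by an imaginary scalar: `‖b‖ ^ 2` grows only by `t ^ 2`, while `‖g b‖ ^ 2` also
    -- gains the cross term `2 * (g a).im * t`, linear in `t`.
    set b : A := a + (Complex.I * t) • (1 : A) with hb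
    have hsb : star b * b = a * a + ((t : ℂ) ^ 2) • (1 : A) := by
      simp only [hb, star_add, star_smul, ha.star_eq, star_one, add_mul, mul_add,
        smul_mul_assoc, mul_smul_comm, one_mul, mul_one, smul_add, smul_smul]
      simp only [StarMul.star_mul, Complex.star_def, Complex.conj_I, Complex.conj_ofReal]
      match_scalars
      · ring
      · ring
      · linear_combination (-(t : ℂ) ^ 2) * Complex.I_mul_I
    have hn : ‖b‖ ^ 2 ≤ ‖a‖ ^ 2 + t ^ 2 := by
      rw [sq, ← CStarRing.norm_star_mul_self, hsb]
      refine (norm_add_le _ _).trans (add_le_add ?_ ?_)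
      · rw [sq]; exact norm_mul_le _ _
      · rw [norm_smul, CStarRing.norm_one, mul_one, norm_pow, Complex.norm_real, Real.norm_eq_abs,
          sq_abs]
    have hgb : ‖g b‖ ^ 2 ≤ ‖b‖ ^ 2 :=
      pow_le_pow_left₀ (norm_nonneg _) (g.le_of_opNorm_le hg b |>.trans_eq (one_mul _)) 2
    have hgb' : ‖g b‖ ^ 2 = (g a).re ^ 2 + ((g a).im + t) ^ 2 := by
      rw [← Complex.normSq_eq_norm_sq, Complex.normSq_apply, hb, map_add, map_smul, h1]
      simp
      ring
    nlinarith [sq_nonneg (g a).re, sq_nonneg (g a).im]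
  by_contra h
  -- This `t` makes the left side of `key` equal to `‖a‖ ^ 2 + 1`.
  have := key ((‖a‖ ^ 2 + 1) / (2 * (g a).im))
  rw [mul_div_cancel₀ _ (by simpa using h)] at this
  linarith

variable [PartialOrder A] [StarOrderedRing A]

/-- A contractive unital functional on a C*-algebra is positive. -/
theorem StrongDual.apply_nonneg_of_norm_le_one {g : StrongDual ℂ A} (hg : ‖g‖ ≤ 1) (h1 : g 1 = 1)
    {a : A} (ha : 0 ≤ a) : 0 ≤ (g a).re := by
  have h : ‖algebraMap ℝ A ‖a‖ - a‖ ≤ ‖a‖ := by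
    refine (CStarAlgebra.norm_le_iff_le_algebraMap _ (norm_nonneg a) ?_).2 (by simpa using ha)
    exact sub_nonneg.2 (IsSelfAdjoint.le_algebraMap_norm_self (.of_nonneg ha))
  have h2 := (g.le_of_opNorm_le hg (algebraMap ℝ A ‖a‖ - a)).trans_eq (one_mul _)
  have h3 : g (algebraMap ℝ A ‖a‖ - a) = ‖a‖ - g a := by
    rw [map_sub, IsScalarTower.algebraMap_apply ℝ ℂ A, Algebra.algebraMap_eq_smul_one, map_smul, h1]
    simp
  rw [h3] at h2
  have h4 := (Complex.re_le_norm _).trans (h2.trans h)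
  simp at h4
  exact h4

open ComplexOrder in
/-- For each nonzero projection of a C*-algebra there is a positive functional that is nonzero
at it. -/
theorem IsStarProjection.exists_positiveLinearMap_ne_zero {p : A} (hp : IsStarProjection p)
    (h0 : p ≠ 0) : ∃ f : A →ₚ[ℂ] ℂ, f p ≠ 0 := by
  have : Nontrivial A := ⟨p, 0, h0⟩
  -- A functional norming `1 + p` has modulus at most 1 at both `1` and `p`, while its values there
  -- add up to `‖1 + p‖ ≥ 2`. Both real parts are thus 1, so `g` is unital, hence positive, and
  -- nonzero at `p`.
  obtain ⟨g, hg, hgx⟩ := exists_dual_vector'' ℂ (1 + p)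
  have hp1 : ‖p‖ ≤ 1 := hp.norm_le
  have hp0 : 0 < ‖p‖ := norm_pos_iff.2 h0
  have hn : 2 ≤ ‖1 + p‖ := by
    have h : (1 + p) * p = (2 : ℂ) • p := by
      rw [add_mul, one_mul, hp.isIdempotentElem.eq, two_smul]
    have h' := norm_mul_le (1 + p) p
    rw [h, norm_smul, Complex.norm_ofNat] at h'
    exact le_of_mul_le_mul_right h' hp0
  have b1 : ‖g 1‖ ≤ 1 := by simpa using g.le_of_opNorm_le hg 1
  have bp : ‖g p‖ ≤ 1 := (g.le_of_opNorm_le hg p).trans (by simpa using hp1)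
  have hre : (g 1).re + (g p).re = ‖1 + p‖ := by
    have := congr_arg Complex.re hgx
    simpa using this
  have r1 := (Complex.re_le_norm (g 1)).trans b1
  have rp := (Complex.re_le_norm (g p)).trans bp
  have e1 : (g 1).re = 1 := by linarith
  have ep : (g p).re = 1 := by linarith
  have h1 : g 1 = 1 := by
    apply Complex.ext
    · simpa using e1
    · have := Complex.sq_norm_sub_sq_re (g 1)
      simp only [Complex.one_im]
      nlinarith [norm_nonneg (g 1)]
  refine ⟨PositiveLinearMap.mk₀ (g : A →ₗ[ℂ] ℂ) fun a ha => ?_, fun h => ?_⟩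
  · rw [Complex.nonneg_iff]
    exact ⟨g.apply_nonneg_of_norm_le_one hg h1 ha,
      (g.im_apply_eq_zero hg h1 (IsSelfAdjoint.of_nonneg ha)).symm⟩
  · have : g p = 0 := h
    rw [this] at ep
    simp at ep

end States

open ComplexOrder in
/-- For each nonzero projection of a C*-algebra there is a representation on a Hilbert space that is
nonzero at it. -/
theorem IsStarProjection.exists_starAlgHom_ne_zero {A : Type u} [CStarAlgebra A] {p : A}
    (hp : IsStarProjection p) (h0 : p ≠ 0) :
    ∃ (K : Type u) (_ : NormedAddCommGroup K) (_ : InnerProductSpace ℂ K) (_ : CompleteSpace K)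
      (π : A →⋆ₐ[ℂ] (K →L[ℂ] K)), π p ≠ 0 := by
  let := CStarAlgebra.spectralOrder A
  have := CStarAlgebra.spectralOrderedRing A
  obtain ⟨f, hf⟩ := hp.exists_positiveLinearMap_ne_zero h0
  refine ⟨f.GNS, inferInstance, inferInstance, inferInstance, f.gnsStarAlgHom, fun h => hf ?_⟩
  -- At the GNS vector of `1`, the operator of `p` yields a vector of squared norm `f (star p * p) =
  -- f p`, so a vanishing operator would force `f p = 0`.
  have h1 := congr_arg (fun T : f.GNS →L[ℂ] f.GNS => T ((f.toPreGNS 1 : f.PreGNS) : f.GNS)) h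
  change f.gnsNonUnitalStarAlgHom p (f.toPreGNS 1 : f.PreGNS) = 0 at h1
  rw [PositiveLinearMap.gnsNonUnitalStarAlgHom_apply_coe] at h1
  have h2 := congr_arg norm h1
  rw [UniformSpace.Completion.norm_coe, norm_zero] at h2
  have h3 := f.preGNS_norm_sq (f.leftMulMapPreGNS p (f.toPreGNS 1))
  rw [h2] at h3
  simpa [hp.isSelfAdjoint.star_eq, hp.isIdempotentElem.eq] using h3.symm

/-! ### Commuting amplifications on a Hilbert space tensor product -/

section TensorProduct

open scoped TensorProduct
open UniformSpace

variable {E : Type*} [NormedAddCommGroup E] [InnerProductSpace ℂ E]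

theorem ContinuousLinearMap.completion_ext {f g : Completion E →L[ℂ] Completion E}
    (h : ∀ x : E, f x = g x) : f = g := by
  ext x
  induction x using Completion.induction_on with
  | hp => exact isClosed_eq f.continuous g.continuous
  | ih x => exact h x

/-- Extension of bounded operators to the completion, as an algebra homomorphism. -/
noncomputable def ContinuousLinearMap.completionAlgHom :
    (E →L[ℂ] E) →ₐ[ℂ] (Completion E →L[ℂ] Completion E) where
  toFun T := T.completion
  map_one' := ContinuousLinearMap.completion_ext fun x => by simp
  map_zero' := ContinuousLinearMap.completion_ext fun x => by simp
  map_mul' S T := ContinuousLinearMap.completion_ext fun x => by simp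
  map_add' S T := ContinuousLinearMap.completion_ext fun x => by simp [Completion.coe_add]
  commutes' c := ContinuousLinearMap.completion_ext fun x => by
    simp [Algebra.algebraMap_eq_smul_one]

theorem ContinuousLinearMap.completionAlgHom_apply_coe (T : E →L[ℂ] E) (x : E) :
    completionAlgHom T (x : Completion E) = ((T x : E) : Completion E) :=
  T.completion_apply_coe x

/-- The algebraic tensor product need not be complete, so adjoints there are expressed by an inner
product identity, which extends by density and continuity. -/
theorem ContinuousLinearMap.star_completionAlgHom {S T : E →L[ℂ] E}
    (h : ∀ x y, inner ℂ (S x) y = inner ℂ x (T y)) :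
    star (completionAlgHom T) = completionAlgHom S := by
  symm
  refine (ContinuousLinearMap.eq_adjoint_iff _ _).2 fun x y => ?_
  induction x, y using Completion.induction_on₂ with
  | hp =>
    exact isClosed_eq
      (((completionAlgHom S).continuous.comp continuous_fst).inner continuous_snd)
      (continuous_fst.inner ((completionAlgHom T).continuous.comp continuous_snd))
  | ih x y =>
    rw [completionAlgHom_apply_coe, completionAlgHom_apply_coe, Completion.inner_coe,
      Completion.inner_coe, h]

variable {H K : Type*} [NormedAddCommGroup H] [InnerProductSpace ℂ H] [CompleteSpace H]
  [NormedAddCommGroup K] [InnerProductSpace ℂ K] [CompleteSpace K]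

theorem TensorProduct.inner_mapL_star (S : H →L[ℂ] H) (T : K →L[ℂ] K) (x y : H ⊗[ℂ] K) :
    inner ℂ (TensorProduct.mapL (star S) (star T) x) y =
      inner ℂ x (TensorProduct.mapL S T y) := by
  induction x using TensorProduct.induction_on with
  | zero => simp
  | add a b ha hb => simp only [map_add, inner_add_left, ha, hb]
  | tmul a b =>
    induction y using TensorProduct.induction_on with
    | zero => simp
    | add c d hc hd => simp only [map_add, inner_add_right, hc, hd]
    | tmul c d =>
      simp [ContinuousLinearMap.star_eq_adjoint,
        ContinuousLinearMap.adjoint_inner_left]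

variable (H K) in
/-- The amplification `S ↦ S ⊗ 1` of operators on `H` to the Hilbert space tensor product. -/
noncomputable def ContinuousLinearMap.rTensorStarAlgHom :
    (H →L[ℂ] H) →⋆ₐ[ℂ] (Completion (H ⊗[ℂ] K) →L[ℂ] Completion (H ⊗[ℂ] K)) where
  toFun S := completionAlgHom (S.rTensor K)
  map_one' := by simp
  map_mul' S T := by rw [rTensor_mul, map_mul]
  map_zero' := by simp
  map_add' S T := by simp
  commutes' c := by simp [Algebra.algebraMap_eq_smul_one]
  map_star' S := (star_completionAlgHom fun x y => by
    have h := TensorProduct.inner_mapL_star S (1 : K →L[ℂ] K) x y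
    rw [star_one] at h
    simpa only [rTensor_eq_mapL] using! h).symm

variable (H K) in
/-- The amplification `T ↦ 1 ⊗ T` of operators on `K` to the Hilbert space tensor product. -/
noncomputable def ContinuousLinearMap.lTensorStarAlgHom :
    (K →L[ℂ] K) →⋆ₐ[ℂ] (Completion (H ⊗[ℂ] K) →L[ℂ] Completion (H ⊗[ℂ] K)) where
  toFun T := completionAlgHom (T.lTensor H)
  map_one' := by simp
  map_mul' S T := by rw [lTensor_mul, map_mul]
  map_zero' := by simp
  map_add' S T := by simp
  commutes' c := by simp [Algebra.algebraMap_eq_smul_one]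
  map_star' T := (star_completionAlgHom fun x y => by
    have h := TensorProduct.inner_mapL_star (1 : H →L[ℂ] H) T x y
    rw [star_one] at h
    simpa only [lTensor_eq_mapL] using! h).symm

namespace ContinuousLinearMap

theorem rTensorStarAlgHom_mul_lTensorStarAlgHom_comm (S : H →L[ℂ] H) (T : K →L[ℂ] K) :
    rTensorStarAlgHom H K S * lTensorStarAlgHom H K T =
      lTensorStarAlgHom H K T * rTensorStarAlgHom H K S := by
  change completionAlgHom (S.rTensor K) * completionAlgHom (T.lTensor H) =
    completionAlgHom (T.lTensor H) * completionAlgHom (S.rTensor K)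
  rw [← map_mul, ← map_mul, mul_def, mul_def, rTensor_comp_lTensor, lTensor_comp_rTensor]

/-- On an elementary tensor `x ⊗ y` the product gives `S x ⊗ T y`, whose norm is `‖S x‖ * ‖T y‖`. -/
theorem rTensorStarAlgHom_mul_lTensorStarAlgHom_ne_zero {S : H →L[ℂ] H} {T : K →L[ℂ] K}
    (hS : S ≠ 0) (hT : T ≠ 0) : rTensorStarAlgHom H K S * lTensorStarAlgHom H K T ≠ 0 := by
  obtain ⟨x, hx⟩ := DFunLike.ne_iff.1 hS
  obtain ⟨y, hy⟩ := DFunLike.ne_iff.1 hT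
  intro h
  have h1 := congr_arg
    (fun R => R ((x ⊗ₜ[ℂ] y : H ⊗[ℂ] K) : Completion (H ⊗[ℂ] K))) h
  change completionAlgHom (S.rTensor K) (completionAlgHom (T.lTensor H) _) = 0 at h1
  rw [completionAlgHom_apply_coe, completionAlgHom_apply_coe, lTensor_tmul, rTensor_tmul,
    ← norm_eq_zero, Completion.norm_coe, TensorProduct.norm_tmul, mul_eq_zero] at h1
  simp only [norm_eq_zero] at h1
  exact h1.elim hx hy

end ContinuousLinearMap

end TensorProduct

/-! ### Quantum vertex transitivity of the disjoint union -/

namespace SimpleGraph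

variable {V : Type u} {W : Type v} [Fintype V] [Fintype W] {X : SimpleGraph V} {Y : SimpleGraph W}

/-- The product of the images of two intertwining magic unitaries in a C*-algebra in which their
entries commute. -/
theorem Intertwines.exists_mul_apply_ne_zero {V W Z : Type*} [Fintype V] [Fintype W] [Fintype Z]
    {X : SimpleGraph V} {Y : SimpleGraph W} {T : SimpleGraph Z} {A A' : Type*} {B : Type w}
    [CStarAlgebra A] [CStarAlgebra A'] [CStarAlgebra B] {U : Matrix V W A} {U' : Matrix W Z A'}
    (hU : IsMagicUnitary U) (hU' : IsMagicUnitary U') (hI : X.Intertwines Y U)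
    (hI' : Y.Intertwines T U') (α : A →⋆ₐ[ℂ] B) (β : A' →⋆ₐ[ℂ] B)
    (hc : ∀ a a', α a * β a' = β a' * α a) {x : V} {y : W} {z : Z}
    (h : α (U x y) * β (U' y z) ≠ 0) :
    ∃ M : Matrix V Z B, IsMagicUnitary M ∧ X.Intertwines T M ∧ M x z ≠ 0 :=
  ⟨U.map α * U'.map β, (hU.map α).mul (hU'.map β) fun _ _ _ _ => hc _ _,
    (hI.map α).mul (hI'.map β), (hU.map α).mul_apply_ne_zero h⟩

open scoped TensorProduct in
/-- If `Y` is quantum vertex transitive and quantum isomorphic to `X`, then for any vertices `x` of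
`X` and `y` of `Y` there is a magic unitary intertwining `X` and `Y` with nonzero entry at
`(x, y)`. -/
theorem QuantumIsomorphic.exists_apply_ne_zero (hq : QuantumIsomorphic.{u, v, w} X Y)
    (hY : Y.IsQuantumVertexTransitive) (x : V) (y : W) :
    ∃ (B : Type (max v w)) (_ : CStarAlgebra B) (U : Matrix V W B),
      IsMagicUnitary U ∧ X.Intertwines Y U ∧ U x y ≠ 0 := by
  obtain ⟨H, _, _, _, _, U, hU, hXY⟩ := hq
  -- The entry of `U` at `(x, y)` itself may vanish; transitivity of `Y` is used to move from `z` to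
  -- `y`.
  obtain ⟨z, hz⟩ := hU.exists_ne_zero x
  have hG := Y.qutGen_isMagicUnitary
  obtain ⟨K, _, _, _, π, hπ⟩ := (hG.proj z y).exists_starAlgHom_ne_zero (hY z y)
  let E := UniformSpace.Completion (H ⊗[ℂ] K)
  have key := Intertwines.exists_mul_apply_ne_zero (B := E →L[ℂ] E) hU (hG.map π) hXY
    (Y.qutGen_intertwines.map π) (ContinuousLinearMap.rTensorStarAlgHom H K)
    (ContinuousLinearMap.lTensorStarAlgHom H K)
  exact ⟨E →L[ℂ] E, _, @key
    (fun S T => ContinuousLinearMap.rTensorStarAlgHom_mul_lTensorStarAlgHom_comm S T) x z y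
    (ContinuousLinearMap.rTensorStarAlgHom_mul_lTensorStarAlgHom_ne_zero hz hπ)⟩

theorem QuantumIsomorphic.card_eq (hq : QuantumIsomorphic.{u, v, w} X Y) :
    Fintype.card V = Fintype.card W := by
  obtain ⟨H, _, _, _, _, U, hU, -⟩ := hq
  have : CharZero (H →L[ℂ] H) :=
    charZero_of_injective_algebraMap (algebraMap ℂ (H →L[ℂ] H)).injective
  exact hU.card_eq

theorem IsQuantumVertexTransitive.sum (hX : X.IsQuantumVertexTransitive)
    (hY : Y.IsQuantumVertexTransitive) (hq : QuantumIsomorphic.{u, v, w} X Y) :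
    (SimpleGraph.sum X Y).IsQuantumVertexTransitive := by
  classical
  rintro (x | x) (y | y)
  · exact .of_magicUnitary (X.qutGen_isMagicUnitary.fromBlocks_diagonal .one)
      (X.qutGen_intertwines.sum_diagonal .one) (hX x y)
  · obtain ⟨B, _, U, hU, hXY, h⟩ := hq.exists_apply_ne_zero hY x y
    exact .of_magicUnitary (hU.fromBlocks_antidiagonal hU.transpose)
      (hXY.sum_antidiagonal hXY.transpose) h
  -- The lower left block is the transpose, so its entry at `(x, y)` is `U y x`.
  · obtain ⟨B, _, U, hU, hXY, h⟩ := hq.exists_apply_ne_zero hY y x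
    exact .of_magicUnitary (hU.fromBlocks_antidiagonal hU.transpose)
      (hXY.sum_antidiagonal hXY.transpose) h
  · exact .of_magicUnitary (IsMagicUnitary.one.fromBlocks_diagonal Y.qutGen_isMagicUnitary)
      (Intertwines.one.sum_diagonal Y.qutGen_intertwines) (hY x y)

end SimpleGraph

/-! ## Graphs with isomorphic connected components -/

namespace SimpleGraph

/-- Graphs all of whose connected components are isomorphic to one fixed graph are determined up
to isomorphism by the number of components. -/
theorem nonempty_iso_of_components {V W Z : Type*} {X : SimpleGraph V} {Y : SimpleGraph W}
    {T : SimpleGraph Z} (hX : ∀ c : X.ConnectedComponent, Nonempty (T ≃g c.toSimpleGraph))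
    (hY : ∀ c : Y.ConnectedComponent, Nonempty (T ≃g c.toSimpleGraph))
    (e : X.ConnectedComponent ≃ Y.ConnectedComponent) : Nonempty (X ≃g Y) := by
  let f c := (hX c).some
  let g c := (hY c).some
  let ψ : ∀ c : X.ConnectedComponent, c.toSimpleGraph ≃g (e c).toSimpleGraph :=
    fun c => (f c).symm.trans (g (e c))
  let ε : V ≃ W := (Equiv.sigmaFiberEquiv X.connectedComponentMk).symm.trans
    ((Equiv.sigmaCongr e fun c => (ψ c).toEquiv).trans
      (Equiv.sigmaFiberEquiv Y.connectedComponentMk))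
  -- Keeping `c` free lets two vertices whose components are only propositionally equal be handled
  -- by the same `ψ c`.
  have hε : ∀ (c : X.ConnectedComponent) (a : V) (ha : X.connectedComponentMk a = c),
      ε a = (ψ c ⟨a, ha⟩ : (e c).supp) := by
    rintro _ a rfl
    rfl
  have hc : ∀ a, Y.connectedComponentMk (ε a) = e (X.connectedComponentMk a) := fun a => by
    rw [hε _ a rfl]
    exact (ψ (X.connectedComponentMk a) ⟨a, rfl⟩).2
  have key : ∀ a b, X.connectedComponentMk b = X.connectedComponentMk a →
      (Y.Adj (ε a) (ε b) ↔ X.Adj a b) := by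
    intro a b h
    rw [hε _ a rfl, hε _ b h]
    exact (ψ (X.connectedComponentMk a)).map_adj_iff (v := ⟨a, rfl⟩) (w := ⟨b, h⟩)
  -- Adjacent vertices share a component on either side, so only pairs within one component matter;
  -- injectivity of `e` pulls this back from `Y`.
  refine ⟨⟨ε, fun {a b} => ⟨fun h => (key a b ?_).1 h, fun h => (key a b ?_).2 h⟩⟩⟩
  · apply e.injective
    rw [← hc, ← hc]
    exact (ConnectedComponent.connectedComponentMk_eq_of_adj h).symm
  · exact (ConnectedComponent.connectedComponentMk_eq_of_adj h).symm

/-- The vertices are fibred over the components, and every fibre is in bijection with `Z`. -/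
theorem card_eq_card_connectedComponent_mul {V Z : Type*} [Finite V] {X : SimpleGraph V}
    {T : SimpleGraph Z} (hX : ∀ c : X.ConnectedComponent, Nonempty (T ≃g c.toSimpleGraph)) :
    Nat.card V = Nat.card X.ConnectedComponent * Nat.card Z := by
  let f c := (hX c).some
  have e : V ≃ X.ConnectedComponent × Z :=
    (Equiv.sigmaFiberEquiv X.connectedComponentMk).symm.trans
      ((Equiv.sigmaCongrRight fun c => (f c).symm.toEquiv).trans (Equiv.sigmaEquivProd _ _))
  rw [Nat.card_congr e, Nat.card_prod]

/-- A graph isomorphism restricts to the components of `v` and of its image. -/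
def Iso.componentIso {V W : Type*} {X : SimpleGraph V} {Y : SimpleGraph W} (φ : X ≃g Y) (v : V) :
    (X.connectedComponentMk v).toSimpleGraph ≃g (Y.connectedComponentMk (φ v)).toSimpleGraph where
  toEquiv := ConnectedComponent.isoEquivSupp φ (X.connectedComponentMk v)
  map_rel_iff' := φ.map_adj_iff

/-! ### Components of a disjoint union -/

variable {V W : Type*} {X : SimpleGraph V} {Y : SimpleGraph W}

theorem reachable_sum_inl {a b : V} :
    (SimpleGraph.sum X Y).Reachable (Sum.inl a) (Sum.inl b) ↔ X.Reachable a b := by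
  refine ⟨fun ⟨p⟩ => ?_, fun h => h.map (Embedding.sumInl (H := Y)).toHom⟩
  -- Induction on a walk needs variable endpoints, so their form as left injections becomes a
  -- hypothesis.
  suffices ∀ {u w : V ⊕ W}, (SimpleGraph.sum X Y).Walk u w → ∀ a b, u = Sum.inl a → w = Sum.inl b →
      X.Reachable a b from this p a b rfl rfl
  intro u w p
  induction p with
  | nil => rintro a b rfl h; rw [Sum.inl.inj h]
  | @cons u v' w h p ih =>
    rintro a b rfl rfl
    rcases v' with c | c
    · exact (Adj.reachable (by simpa using h)).trans (ih c b rfl rfl)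
    · simp at h

/-- The component of a vertex is not changed by passing to a disjoint union. -/
theorem nonempty_componentIso_sum_inl (a : V) :
    Nonempty ((X.connectedComponentMk a).toSimpleGraph ≃g
      ((SimpleGraph.sum X Y).connectedComponentMk (Sum.inl a)).toSimpleGraph) := by
  have hmem : ∀ b, b ∈ (X.connectedComponentMk a).supp ↔
      Sum.inl b ∈ ((SimpleGraph.sum X Y).connectedComponentMk (Sum.inl a)).supp := fun b => by
    simp only [ConnectedComponent.mem_supp_iff, ConnectedComponent.eq]
    exact reachable_sum_inl.symm
  refine ⟨⟨Equiv.ofBijective (fun b => ⟨Sum.inl b.1, (hmem b.1).1 b.2⟩) ⟨?_, ?_⟩, ?_⟩⟩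
  · rintro ⟨b, hb⟩ ⟨c, hc⟩ h
    simpa using h
  · rintro ⟨b | b, hb⟩
    · exact ⟨⟨b, (hmem b).2 hb⟩, rfl⟩
    · exact absurd (ConnectedComponent.exact hb).symm (not_reachable_sum_inl_inr _ _)
  · rintro ⟨b, hb⟩ ⟨c, hc⟩
    exact sum_adj_inl (G := X) (H := Y)

theorem nonempty_componentIso_sum_inr (a : W) :
    Nonempty ((Y.connectedComponentMk a).toSimpleGraph ≃g
      ((SimpleGraph.sum X Y).connectedComponentMk (Sum.inr a)).toSimpleGraph) := by
  obtain ⟨f⟩ := nonempty_componentIso_sum_inl (X := Y) (Y := X) a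
  exact ⟨f.trans ((Iso.sumComm (G := Y) (H := X)).componentIso (Sum.inl a))⟩

/-- If the disjoint union of two finite graphs of the same order is vertex transitive, then the
graphs are isomorphic. -/
theorem IsVertexTransitive.nonempty_iso_of_sum [Finite V] [Finite W]
    (hcard : Nat.card V = Nat.card W) (h : (SimpleGraph.sum X Y).IsVertexTransitive) : Nonempty (X ≃g Y) := by
  rcases isEmpty_or_nonempty V with hV | ⟨⟨v₀⟩⟩
  · have : IsEmpty W := by
      rw [← Finite.card_eq_zero_iff, ← hcard, Finite.card_eq_zero_iff]
      exact hV
    exact ⟨⟨Equiv.equivOfIsEmpty V W, fun {a} => isEmptyElim a⟩⟩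
  set c₀ := (SimpleGraph.sum X Y).connectedComponentMk (Sum.inl v₀) with hc₀
  have hS : ∀ s, Nonempty
      (c₀.toSimpleGraph ≃g ((SimpleGraph.sum X Y).connectedComponentMk s).toSimpleGraph) := by
    intro s
    obtain ⟨φ, rfl⟩ := h (Sum.inl v₀) s
    exact ⟨φ.componentIso _⟩
  have hX : ∀ c : X.ConnectedComponent, Nonempty (c₀.toSimpleGraph ≃g c.toSimpleGraph) := by
    intro c
    obtain ⟨a, rfl⟩ := c.exists_rep
    obtain ⟨f⟩ := hS (Sum.inl a)
    obtain ⟨g⟩ := nonempty_componentIso_sum_inl (X := X) (Y := Y) a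
    exact ⟨f.trans g.symm⟩
  have hY : ∀ c : Y.ConnectedComponent, Nonempty (c₀.toSimpleGraph ≃g c.toSimpleGraph) := by
    intro c
    obtain ⟨a, rfl⟩ := c.exists_rep
    obtain ⟨f⟩ := hS (Sum.inr a)
    obtain ⟨g⟩ := nonempty_componentIso_sum_inr (X := X) (Y := Y) a
    exact ⟨f.trans g.symm⟩
  -- The common component is nonempty, so its size can be cancelled from the two vertex counts.
  have hpos : 0 < Nat.card c₀ :=
    have : Nonempty c₀ := ⟨⟨Sum.inl v₀, rfl⟩⟩
    Nat.card_pos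
  have hcc : Nat.card X.ConnectedComponent = Nat.card Y.ConnectedComponent := by
    rw [card_eq_card_connectedComponent_mul hX, card_eq_card_connectedComponent_mul hY] at hcard
    exact Nat.eq_of_mul_eq_mul_right hpos hcard
  exact nonempty_iso_of_components hX hY (Finite.card_eq.1 hcc).some

end SimpleGraph

/-- If `X` and `Y` are finite quantum vertex transitive graphs that are quantum isomorphic but not
isomorphic, then their disjoint union is quantum vertex transitive but not vertex transitive. -/
theorem theorem4p15 {V : Type u} {W : Type v} [Fintype V] [Fintype W]
    (X : SimpleGraph V) (Y : SimpleGraph W)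
    (hX : X.IsQuantumVertexTransitive) (hY : Y.IsQuantumVertexTransitive)
    (hq : SimpleGraph.QuantumIsomorphic.{u, v, w} X Y) (hni : ¬ Nonempty (X ≃g Y)) :
    (SimpleGraph.sum X Y).IsQuantumVertexTransitive ∧
      ¬ (SimpleGraph.sum X Y).IsVertexTransitive := by
  refine ⟨hX.sum hY hq, fun h => hni (h.nonempty_iso_of_sum ?_)⟩
  rw [Nat.card_eq_fintype_card, Nat.card_eq_fintype_card, hq.card_eq]
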